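/- Let $n\ge 1$. All manifolds are smooth and may be empty or disconnected; closed means compact without boundary; $\overline{M}$ is $M$ with the opposite orientation; boundaries carry the boundary orientation (outward normal first). If $X,Y$ are compact oriented $n$-manifolds with boundary and $f:\partial X\to\overline{\partial Y}$ is an orientation-preserving diffeomorphism, then $X\cup_f Y$ denotes the closed oriented $n$-manifold obtained by gluing $X$ and $Y$ along $f$ (well defined up to orientation-preserving diffeomorphism): it is the union of smoothly and orientation-preservingly embedded copies of $X$ and $Y$ which meet exactly in their boundaries, identified by $f$. The double of $X$ is $D(X)=X\cup_{\mathrm{id}_{\partial X}}\overline{X}$. Let $\mathbb{M}_n$ be the commutative monoid of closed oriented $n$-manifolds up to orientation-preserving diffeomorphism, under disjoint union, and $\mathcal{G}(\mathbb{M}_n)$ its Grothendieck group. Let $SKK_n$ be the quotient of $\mathcal{G}(\mathbb{M}_n)$ by the subgroup generated by all elements $$[X\cup_f Y]-[X\cup_g Y]-[X'\cup_f Y']+[X'\cup_g Y'],$$ where $X,X'$ are compact oriented $n$-manifolds with the same boundary $\Sigma$, $Y,Y'$ are compact oriented $n$-manifolds with the same boundary $\Sigma'$, and $f,g:\Sigma\to\overline{\Sigma'}$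 are orientation-preserving diffeomorphisms (having boundary $\Sigma$ means that an orientation-preserving identification of $\Sigma$ with the boundary is given). **Lemma.** Let $X_1,X_2,X_3$ be compact oriented $n$-manifolds with boundaries $\Sigma_1,\Sigma_2,\Sigma_3$, and let $f:\Sigma_1\to\Sigma_2$ and $g:\Sigma_2\to\overline{\Sigma_3}$ be orientation-preserving diffeomorphisms. Then in $SKK_n$ $$[X_1\cup_f\overline{X_2}]+[X_2\cup_g X_3]=[X_1\cup_{g\circ f}X_3]+[D(X_2)].$$ -/

import Mathlib

open scoped Manifold ContDiff Topology

universe u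

noncomputable section

namespace CutPaste

/-! ### Orientations of manifolds -/

section Orientation

/-- `v` is a basis of `V` lying in the orientation `o`. (If `V = 0`, the two orientations of `V`
are the two signs, and the empty family is positive for exactly one of them.) -/
def PositiveFrame {V : Type*} [AddCommGroup V] [Module ℝ V] {n : ℕ}
    (o : Orientation ℝ V (Fin n)) (v : Fin n → V) : Prop :=
  ∃ b : Module.Basis (Fin n) ℝ V, ⇑b = v ∧ b.orientation = o

theorem orientation_neg_neg {V : Type*} [AddCommGroup V] [Module ℝ V] {n : ℕ}
    (o : Orientation ℝ V (Fin n)) : - -o = o := by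
  induction o using Module.Ray.ind with
  | h v hv => rw [neg_rayOfNeZero, neg_rayOfNeZero]; simp only [neg_neg]

theorem positiveFrame_neg_basis {V : Type*} [AddCommGroup V] [Module ℝ V] {n : ℕ}
    (b : Module.Basis (Fin n) ℝ V) (o : Orientation ℝ V (Fin n)) :
    PositiveFrame (-o) b ↔ ¬ PositiveFrame o b := by
  have key : ∀ o : Orientation ℝ V (Fin n), PositiveFrame o b ↔ b.orientation = o := by
    intro o
    constructor
    · rintro ⟨c, hc, rfl⟩
      rw [DFunLike.coe_injective hc]
    · intro h
      exact ⟨b, rfl, h⟩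
  rw [key, key]
  have h := b.orientation_ne_iff_eq_neg o
  constructor
  · intro h1 h2
    have : o = -b.orientation := by rw [h1, orientation_neg_neg]
    exact (h.2 this) h2.symm
  · intro h1
    rw [h.1 (fun e => h1 e.symm), orientation_neg_neg]

theorem positiveFrame_neg_zero {V : Type*} [AddCommGroup V] [Module ℝ V]
    (b : Module.Basis (Fin 0) ℝ V) (o : Orientation ℝ V (Fin 0)) (v : Fin 0 → V) :
    PositiveFrame (-o) v ↔ ¬ PositiveFrame o v := by
  rw [Subsingleton.elim v b]
  exact positiveFrame_neg_basis b o

theorem PositiveFrame.flip {V : Type*} [AddCommGroup V] [Module ℝ V] {n : ℕ}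
    {o : Orientation ℝ V (Fin n)} {v : Fin n → V} (h : PositiveFrame o v) (k : Fin n) :
    PositiveFrame (-o) (Function.update v k (-v k)) := by
  obtain ⟨b, rfl, rfl⟩ := h
  refine ⟨b.unitsSMul (Function.update 1 k (-1)), ?_, b.orientation_neg_single k⟩
  funext i
  by_cases hi : i = k
  · subst hi
    simp [Module.Basis.unitsSMul_apply]
  · simp [Module.Basis.unitsSMul_apply, hi]

theorem positiveFrame_neg_flip {V : Type*} [AddCommGroup V] [Module ℝ V] {n : ℕ}
    (o : Orientation ℝ V (Fin n)) (v : Fin n → V) (k : Fin n) :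
    PositiveFrame (-o) v ↔ PositiveFrame o (Function.update v k (-v k)) := by
  constructor
  · intro h
    simpa [orientation_neg_neg] using h.flip k
  · intro h
    simpa using h.flip k

theorem positiveFrame_neg_iff {V W : Type*} [AddCommGroup V] [Module ℝ V] [AddCommGroup W]
    [Module ℝ W] {n : ℕ} (bV : Module.Basis (Fin n) ℝ V) (bW : Module.Basis (Fin n) ℝ W)
    {o : Orientation ℝ V (Fin n)} {o' : Orientation ℝ W (Fin n)} (L : V →ₗ[ℝ] W)
    (h : ∀ v, PositiveFrame o v ↔ PositiveFrame o' (fun i => L (v i))) (v : Fin n → V) :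
    PositiveFrame (-o) v ↔ PositiveFrame (-o') (fun i => L (v i)) := by
  cases n with
  | zero => rw [positiveFrame_neg_zero bV, positiveFrame_neg_zero bW, h]
  | succ n =>
    rw [positiveFrame_neg_flip _ _ 0, positiveFrame_neg_flip _ _ 0, h]
    congr! 1
    funext i
    by_cases hi : i = 0
    · subst hi; simp
    · simp [hi]

variable {n : ℕ} {E H : Type*} [NormedAddCommGroup E] [NormedSpace ℝ E] [TopologicalSpace H]
  (I : ModelWithCorners ℝ E H)
  {E' H' : Type*} [NormedAddCommGroup E'] [NormedSpace ℝ E'] [TopologicalSpace H']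
  (I' : ModelWithCorners ℝ E' H')
  {E'' H'' : Type*} [NormedAddCommGroup E''] [NormedSpace ℝ E''] [TopologicalSpace H'']
  (I'' : ModelWithCorners ℝ E'' H'')
  {M M' M'' : Type*} [TopologicalSpace M] [ChartedSpace H M]

/-- A choice of orientations of all tangent spaces is an orientation of the manifold if it is
locally constant when read in charts. -/
def IsOrientation (o : ∀ x : M, Orientation ℝ (TangentSpace I x) (Fin n)) : Prop :=
  ∀ x₀ : M, ∃ o₀ : Orientation ℝ E (Fin n), ∀ᶠ x in 𝓝 x₀, ∀ v : Fin n → TangentSpace I x,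
    PositiveFrame (o x) v ↔
      PositiveFrame o₀ (fun i => (mfderiv I 𝓘(ℝ, E) (extChartAt I x₀) x (v i) : E))

/-- The differential of `f` carries positive frames, and only those, to positive frames. Between
manifolds of dimension `n` this forces the differential to be bijective at every point. -/
def PreservesOrientation [TopologicalSpace M'] [ChartedSpace H' M']
    (o : ∀ x : M, Orientation ℝ (TangentSpace I x) (Fin n))
    (o' : ∀ y : M', Orientation ℝ (TangentSpace I' y) (Fin n)) (f : M → M') : Prop :=
  ∀ (x : M) (v : Fin n → TangentSpace I x),
    PositiveFrame (o x) v ↔ PositiveFrame (o' (f x)) (fun i => mfderiv I I' f x (v i))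

theorem IsOrientation.neg (bE : Module.Basis (Fin n) ℝ E)
    {o : ∀ x : M, Orientation ℝ (TangentSpace I x) (Fin n)} (h : IsOrientation I o) :
    IsOrientation I (fun x => -o x) := by
  intro x₀
  obtain ⟨o₀, ho⟩ := h x₀
  refine ⟨-o₀, ho.mono fun x hx v => ?_⟩
  exact positiveFrame_neg_iff (V := TangentSpace I x) (W := E) bE bE
    (mfderiv I 𝓘(ℝ, E) (extChartAt I x₀) x).toLinearMap hx v

/-- The orientation of a disjoint union that restricts to the given ones on the two parts
(the tangent space at a point of a part is the tangent space of that part). -/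
def sumOrient {N : Type*} [TopologicalSpace N] [ChartedSpace H N]
    (o : ∀ x : M, Orientation ℝ (TangentSpace I x) (Fin n))
    (o' : ∀ y : N, Orientation ℝ (TangentSpace I y) (Fin n)) :
    ∀ z : M ⊕ N, Orientation ℝ (TangentSpace I z) (Fin n)
  | .inl x => o x
  | .inr y => o' y

theorem preservesOrientation_id (o : ∀ x : M, Orientation ℝ (TangentSpace I x) (Fin n)) :
    PreservesOrientation I I o o id := by
  intro x v
  simp only [mfderiv_id]
  exact Iff.rfl

variable {I I' I''} in
theorem PreservesOrientation.comp [TopologicalSpace M'] [ChartedSpace H' M']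
    [TopologicalSpace M''] [ChartedSpace H'' M'']
    {o : ∀ x : M, Orientation ℝ (TangentSpace I x) (Fin n)}
    {o' : ∀ y : M', Orientation ℝ (TangentSpace I' y) (Fin n)}
    {o'' : ∀ y : M'', Orientation ℝ (TangentSpace I'' y) (Fin n)} {f : M → M'} {g : M' → M''}
    (hg : PreservesOrientation I' I'' o' o'' g) (hf : PreservesOrientation I I' o o' f)
    (dg : MDifferentiable I' I'' g) (df : MDifferentiable I I' f) :
    PreservesOrientation I I'' o o'' (g ∘ f) := by
  intro x v
  rw [hf x v, hg (f x), mfderiv_comp x (dg (f x)) (df x)]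
  exact Iff.rfl

variable {I I'} in
theorem PreservesOrientation.symm [TopologicalSpace M'] [ChartedSpace H' M']
    {o : ∀ x : M, Orientation ℝ (TangentSpace I x) (Fin n)}
    {o' : ∀ y : M', Orientation ℝ (TangentSpace I' y) (Fin n)} (φ : M ≃ₘ⟮I, I'⟯ M')
    (h : PreservesOrientation I I' o o' φ) : PreservesOrientation I' I o' o φ.symm := by
  intro y v
  obtain ⟨x, rfl⟩ : ∃ x, φ x = y := φ.surjective y
  have hx : φ.symm (φ x) = x := φ.symm_apply_apply x
  have d1 : MDifferentiable I I' φ := φ.mdifferentiable (by simp)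
  have d2 : MDifferentiable I' I φ.symm := φ.symm.mdifferentiable (by simp)
  have hc := mfderiv_comp (φ x) (I := I') (I' := I) (I'' := I') (d1 (φ.symm (φ x))) (d2 (φ x))
  have hid : (φ ∘ φ.symm : M' → M') = id := by
    funext z; exact φ.apply_symm_apply z
  rw [hid, mfderiv_id] at hc
  rw [h (φ.symm (φ x))]
  have hv : ∀ i, mfderiv I I' φ (φ.symm (φ x)) (mfderiv I' I φ.symm (φ x) (v i)) = v i := by
    intro i
    have := congrArg (fun L => L (v i)) hc
    exact this.symm
  simp only [hv]
  exact Iff.of_eq (by rw [hx])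

section Sum

variable {N : Type*} [TopologicalSpace N] [ChartedSpace H N]
  {o : ∀ x : M, Orientation ℝ (TangentSpace I x) (Fin n)}
  {o' : ∀ y : N, Orientation ℝ (TangentSpace I y) (Fin n)}

theorem preservesOrientation_inl :
    PreservesOrientation I I o (sumOrient I o o') (Sum.inl : M → M ⊕ N) := by
  intro x v
  rw [mfderiv_sumInl (p := Sum.inl x)]
  exact Iff.rfl

theorem preservesOrientation_inr :
    PreservesOrientation I I o' (sumOrient I o o') (Sum.inr : N → M ⊕ N) := by
  intro x v
  rw [mfderiv_sumInr]
  exact Iff.rfl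

theorem mfderiv_inl_apply [TopologicalSpace M'] [ChartedSpace H' M'] {f : M ⊕ N → M'} {x : M}
    (hf : MDifferentiableAt I I' f (Sum.inl x)) (v : TangentSpace I x) :
    mfderiv I I' (f ∘ Sum.inl) x v = mfderiv I I' f (Sum.inl x) v := by
  rw [mfderiv_comp x hf (ContMDiff.inl (n := 1) |>.mdifferentiable (by simp) x),
    mfderiv_sumInl (p := Sum.inl x)]
  rfl

theorem mfderiv_inr_apply [TopologicalSpace M'] [ChartedSpace H' M'] {f : M ⊕ N → M'} {x : N}
    (hf : MDifferentiableAt I I' f (Sum.inr x)) (v : TangentSpace I x) :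
    mfderiv I I' (f ∘ Sum.inr) x v = mfderiv I I' f (Sum.inr x) v := by
  rw [mfderiv_comp x hf (ContMDiff.inr (n := 1) |>.mdifferentiable (by simp) x),
    mfderiv_sumInr]
  rfl

variable {I I'} in
theorem PreservesOrientation.of_sum [TopologicalSpace M'] [ChartedSpace H' M']
    {o'' : ∀ y : M', Orientation ℝ (TangentSpace I' y) (Fin n)} {f : M ⊕ N → M'}
    (df : MDifferentiable I I' f)
    (h₁ : PreservesOrientation I I' o o'' (f ∘ Sum.inl))
    (h₂ : PreservesOrientation I I' o' o'' (f ∘ Sum.inr)) :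
    PreservesOrientation I I' (sumOrient I o o') o'' f := by
  rintro (x | x) v
  · exact (h₁ x v).trans (iff_of_eq (congrArg (PositiveFrame (o'' (f (Sum.inl x))))
      (funext fun i => mfderiv_inl_apply I I' (df (Sum.inl x)) (v i))))
  · exact (h₂ x v).trans (iff_of_eq (congrArg (PositiveFrame (o'' (f (Sum.inr x))))
      (funext fun i => mfderiv_inr_apply I I' (df (Sum.inr x)) (v i))))

variable {I} in
theorem IsOrientation.sum [IsManifold I 1 M] [IsManifold I 1 N]
    (h : IsOrientation I o) (h' : IsOrientation I o') :
    IsOrientation I (sumOrient I o o') := by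
  rintro (x₀ | x₀)
  · obtain ⟨o₀, ho⟩ := h x₀
    refine ⟨o₀, ?_⟩
    have h1 : ∀ᶠ z in 𝓝 (Sum.inl x₀ : M ⊕ N), z ∈ (extChartAt I (Sum.inl x₀ : M ⊕ N)).source :=
      extChartAt_source_mem_nhds _
    rw [nhds_inl] at h1 ⊢
    rw [Filter.eventually_map] at h1 ⊢
    filter_upwards [ho, h1] with x hx hs v
    refine (hx v).trans ?_
    have hd : MDifferentiableAt I 𝓘(ℝ, E) (extChartAt I (Sum.inl x₀ : M ⊕ N)) (Sum.inl x) :=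
      mdifferentiableAt_extChartAt (by simpa using hs)
    have he : (extChartAt I (Sum.inl x₀ : M ⊕ N)) ∘ Sum.inl = extChartAt I x₀ := by
      funext y; simp
    rw [← he]
    exact iff_of_eq (congrArg (PositiveFrame o₀)
      (funext fun i => mfderiv_inl_apply I 𝓘(ℝ, E) hd (v i)))
  · obtain ⟨o₀, ho⟩ := h' x₀
    refine ⟨o₀, ?_⟩
    have h1 : ∀ᶠ z in 𝓝 (Sum.inr x₀ : M ⊕ N), z ∈ (extChartAt I (Sum.inr x₀ : M ⊕ N)).source :=
      extChartAt_source_mem_nhds _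
    rw [nhds_inr] at h1 ⊢
    rw [Filter.eventually_map] at h1 ⊢
    filter_upwards [ho, h1] with x hx hs v
    refine (hx v).trans ?_
    have hd : MDifferentiableAt I 𝓘(ℝ, E) (extChartAt I (Sum.inr x₀ : M ⊕ N)) (Sum.inr x) :=
      mdifferentiableAt_extChartAt (by simpa using hs)
    have he : (extChartAt I (Sum.inr x₀ : M ⊕ N)) ∘ Sum.inr = extChartAt I x₀ := by
      funext y; simp
    rw [← he]
    exact iff_of_eq (congrArg (PositiveFrame o₀)
      (funext fun i => mfderiv_inr_apply I 𝓘(ℝ, E) hd (v i)))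

end Sum

end Orientation

/-! ### Closed oriented manifolds and their monoid -/

/-- Closed (compact, without boundary) oriented smooth manifolds of dimension `n`, possibly empty
or disconnected. -/
structure ClosedManifold (n : ℕ) : Type (u + 1) where
  carrier : Type u
  [top : TopologicalSpace carrier]
  [t2 : T2Space carrier]
  [compact : CompactSpace carrier]
  [charted : ChartedSpace (EuclideanSpace ℝ (Fin n)) carrier]
  [smooth : IsManifold (𝓡 n) ∞ carrier]
  orient : ∀ x : carrier, Orientation ℝ (TangentSpace (𝓡 n) x) (Fin n)
  isOrientation : IsOrientation (𝓡 n) orient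

namespace ClosedManifold

attribute [instance] top t2 compact charted smooth

instance (n : ℕ) : CoeSort (ClosedManifold.{u} n) (Type u) := ⟨carrier⟩

/-- The same manifold with the opposite orientation. -/
abbrev reverse {n : ℕ} (M : ClosedManifold.{u} n) : ClosedManifold.{u} n where
  carrier := M.carrier
  orient := fun x => -M.orient x
  isOrientation := M.isOrientation.neg _ (EuclideanSpace.basisFun (Fin n) ℝ).toBasis

/-- Disjoint union. -/
abbrev sum {n : ℕ} (M N : ClosedManifold.{u} n) : ClosedManifold.{u} n where
  carrier := M.carrier ⊕ N.carrier
  orient := sumOrient (𝓡 n) M.orient N.orient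
  isOrientation :=
    haveI : IsManifold (𝓡 n) 1 M.carrier := .of_le (n := ∞) (by simp)
    haveI : IsManifold (𝓡 n) 1 N.carrier := .of_le (n := ∞) (by simp)
    M.isOrientation.sum N.isOrientation

/-- The empty manifold. -/
def empty (n : ℕ) : ClosedManifold.{u} n where
  carrier := PEmpty.{u + 1}
  charted := ChartedSpace.empty (EuclideanSpace ℝ (Fin n)) PEmpty.{u + 1}
  smooth := letI := ChartedSpace.empty (EuclideanSpace ℝ (Fin n)) PEmpty.{u + 1}; inferInstance
  orient := fun x => x.elim
  isOrientation := fun x => x.elim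

/-- Orientation-preserving diffeomorphism. -/
def OrientedDiffeomorphic {n : ℕ} (M N : ClosedManifold.{u} n) : Prop :=
  ∃ φ : M ≃ₘ⟮𝓡 n, 𝓡 n⟯ N, PreservesOrientation (𝓡 n) (𝓡 n) M.orient N.orient φ

instance setoid (n : ℕ) : Setoid (ClosedManifold.{u} n) where
  r := OrientedDiffeomorphic
  iseqv :=
    { refl := fun M => ⟨Diffeomorph.refl _ _ _, preservesOrientation_id _ _⟩
      symm := fun ⟨φ, h⟩ => ⟨φ.symm, h.symm φ⟩
      trans := fun ⟨φ, h⟩ ⟨ψ, k⟩ => ⟨φ.trans ψ,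
        k.comp h (ψ.mdifferentiable (by simp)) (φ.mdifferentiable (by simp))⟩ }

theorem mdiff_inl {n : ℕ} (M N : ClosedManifold.{u} n) :
    MDifferentiable (𝓡 n) (𝓡 n) (Sum.inl : M → M ⊕ N) :=
  (ContMDiff.inl (n := 1)).mdifferentiable (by simp)

theorem mdiff_inr {n : ℕ} (M N : ClosedManifold.{u} n) :
    MDifferentiable (𝓡 n) (𝓡 n) (Sum.inr : N → M ⊕ N) :=
  (ContMDiff.inr (n := 1)).mdifferentiable (by simp)

theorem sum_congr {n : ℕ} {M M' N N' : ClosedManifold.{u} n} (h : M ≈ M') (k : N ≈ N') :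
    M.sum N ≈ M'.sum N' := by
  obtain ⟨φ, hφ⟩ := h
  obtain ⟨ψ, hψ⟩ := k
  refine ⟨Diffeomorph.sumCongr φ ψ, PreservesOrientation.of_sum
    ((Diffeomorph.sumCongr φ ψ).mdifferentiable (by simp)) ?_ ?_⟩
  · exact (preservesOrientation_inl (𝓡 n)).comp hφ (mdiff_inl _ _) (φ.mdifferentiable (by simp))
  · exact (preservesOrientation_inr (𝓡 n)).comp hψ (mdiff_inr _ _) (ψ.mdifferentiable (by simp))

theorem sum_comm {n : ℕ} (M N : ClosedManifold.{u} n) : M.sum N ≈ N.sum M :=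
  ⟨Diffeomorph.sumComm _ _ _ _, PreservesOrientation.of_sum
    ((Diffeomorph.sumComm _ _ _ _).mdifferentiable (by simp))
    (preservesOrientation_inr (𝓡 n)) (preservesOrientation_inl (𝓡 n))⟩

theorem sum_assoc {n : ℕ} (M N P : ClosedManifold.{u} n) :
    (M.sum N).sum P ≈ M.sum (N.sum P) := by
  have d := (Diffeomorph.sumAssoc (𝓡 n) M ∞ N P).mdifferentiable (by simp)
  refine ⟨Diffeomorph.sumAssoc _ _ _ _ _, PreservesOrientation.of_sum d
    (PreservesOrientation.of_sum (d.comp (mdiff_inl (M.sum N) P)) ?_ ?_) ?_⟩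
  · exact preservesOrientation_inl (𝓡 n)
  · exact (preservesOrientation_inr (𝓡 n)).comp (preservesOrientation_inl (𝓡 n))
      (mdiff_inr M (N.sum P)) (mdiff_inl N P)
  · exact (preservesOrientation_inr (𝓡 n)).comp (preservesOrientation_inr (𝓡 n))
      (mdiff_inr M (N.sum P)) (mdiff_inr N P)

theorem sum_empty {n : ℕ} (M : ClosedManifold.{u} n) : M.sum (empty n) ≈ M :=
  haveI : IsEmpty (empty.{u} n).carrier := inferInstanceAs (IsEmpty PEmpty.{u + 1})
  ⟨Diffeomorph.sumEmpty (M' := (empty.{u} n).carrier) (𝓡 n) M ∞, PreservesOrientation.of_sum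
    ((Diffeomorph.sumEmpty (M' := (empty.{u} n).carrier) (𝓡 n) M ∞).mdifferentiable (by simp))
    (preservesOrientation_id _ _) (fun x => isEmptyElim x)⟩

end ClosedManifold

/-- Oriented diffeomorphism classes of closed oriented `n`-manifolds. -/
def ManifoldClass (n : ℕ) : Type (u + 1) := Quotient (ClosedManifold.setoid.{u} n)

/-- Disjoint union. -/
instance (n : ℕ) : Add (ManifoldClass.{u} n) where
  add := Quotient.map₂ ClosedManifold.sum fun _ _ h _ _ k => ClosedManifold.sum_congr h k

/-- The class of the empty manifold. -/
instance (n : ℕ) : Zero (ManifoldClass.{u} n) where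
  zero := Quotient.mk _ (ClosedManifold.empty n)

instance (n : ℕ) : AddCommMonoid (ManifoldClass.{u} n) where
  add_assoc := by
    rintro ⟨M⟩ ⟨N⟩ ⟨P⟩
    exact Quotient.sound (ClosedManifold.sum_assoc M N P)
  add_comm := by
    rintro ⟨M⟩ ⟨N⟩
    exact Quotient.sound (ClosedManifold.sum_comm M N)
  zero_add := by
    rintro ⟨M⟩
    exact Quotient.sound (Setoid.trans (ClosedManifold.sum_comm _ M) (ClosedManifold.sum_empty M))
  add_zero := by
    rintro ⟨M⟩
    exact Quotient.sound (ClosedManifold.sum_empty M)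
  nsmul := nsmulRec

/-- The Grothendieck group of the monoid of closed oriented `n`-manifolds. -/
abbrev ManifoldGroup (n : ℕ) : Type (u + 1) := Algebra.GrothendieckAddGroup (ManifoldClass.{u} n)

/-- The class of a closed oriented manifold in the Grothendieck group. -/
def ManifoldGroup.mk {n : ℕ} (M : ClosedManifold.{u} n) : ManifoldGroup.{u} n :=
  Algebra.GrothendieckAddGroup.of (Quotient.mk (ClosedManifold.setoid n) M)

/-! ### Manifolds with boundary, gluing and doubles -/

/-- At a boundary point `x` of a manifold modelled on the half-space `{y | 0 ≤ y 0}`, the tangent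
vectors that point out of the manifold. -/
def IsOutward {m : ℕ} {X : Type*} [TopologicalSpace X]
    [ChartedSpace (EuclideanHalfSpace (m + 1)) X] (x : X)
    (ν : TangentSpace (𝓡∂ (m + 1)) x) : Prop :=
  let w : EuclideanSpace ℝ (Fin (m + 1)) :=
    mfderiv (𝓡∂ (m + 1)) 𝓘(ℝ, EuclideanSpace ℝ (Fin (m + 1))) (extChartAt (𝓡∂ (m + 1)) x) x ν
  w 0 < 0

/-- Compact oriented smooth `(m + 1)`-manifolds with boundary `S`: the closed oriented
`m`-manifold `S` is identified by `incl` with the boundary, with its boundary orientation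
(outward normal first). -/
structure ManifoldWithBoundary {m : ℕ} (S : ClosedManifold.{u} m) : Type (u + 1) where
  carrier : Type u
  [top : TopologicalSpace carrier]
  [t2 : T2Space carrier]
  [compact : CompactSpace carrier]
  [charted : ChartedSpace (EuclideanHalfSpace (m + 1)) carrier]
  [smooth : IsManifold (𝓡∂ (m + 1)) ∞ carrier]
  orient : ∀ x : carrier, Orientation ℝ (TangentSpace (𝓡∂ (m + 1)) x) (Fin (m + 1))
  isOrientation : IsOrientation (𝓡∂ (m + 1)) orient
  /-- The identification of `S` with the boundary, a smooth embedding. -/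
  incl : S → carrier
  contMDiff_incl : ContMDiff (𝓡 m) (𝓡∂ (m + 1)) ∞ incl
  isEmbedding_incl : Topology.IsEmbedding incl
  mfderiv_incl_injective : ∀ s, Function.Injective (mfderiv (𝓡 m) (𝓡∂ (m + 1)) incl s)
  range_incl : Set.range incl = (𝓡∂ (m + 1)).boundary carrier
  boundary_orient : ∀ (s : S) (ν : TangentSpace (𝓡∂ (m + 1)) (incl s)), IsOutward (incl s) ν →
    ∀ v : Fin m → TangentSpace (𝓡 m) s, PositiveFrame (S.orient s) v ↔
      PositiveFrame (orient (incl s))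
        (Fin.cons ν fun i => mfderiv (𝓡 m) (𝓡∂ (m + 1)) incl s (v i))

namespace ManifoldWithBoundary

attribute [instance] top t2 compact charted smooth

instance {m : ℕ} (S : ClosedManifold.{u} m) :
    CoeSort (ManifoldWithBoundary S) (Type u) := ⟨carrier⟩

/-- Reversing the orientation of a manifold reverses the orientation of its boundary. -/
theorem boundary_orient_neg {m : ℕ} {S : ClosedManifold.{u} m} (X : ManifoldWithBoundary S)
    (s : S) (ν : TangentSpace (𝓡∂ (m + 1)) (X.incl s)) (hν : IsOutward (X.incl s) ν)
    (v : Fin m → TangentSpace (𝓡 m) s) : PositiveFrame (-S.orient s) v ↔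
      PositiveFrame (-X.orient (X.incl s))
        (Fin.cons ν fun i => mfderiv (𝓡 m) (𝓡∂ (m + 1)) X.incl s (v i)) := by
  cases m with
  | zero =>
    refine (positiveFrame_neg_zero (V := TangentSpace (𝓡 0) s)
      (EuclideanSpace.basisFun (Fin 0) ℝ).toBasis _ v).trans ?_
    refine (not_congr (X.boundary_orient s ν hν v)).trans ?_
    have hν0 : ν ≠ 0 := by
      rintro rfl
      unfold IsOutward at hν
      rw [map_zero] at hν
      exact lt_irrefl (0 : ℝ) hν
    let V := EuclideanSpace ℝ (Fin (0 + 1))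
    let w : Fin (0 + 1) → V := Fin.cons ν fun i => mfderiv (𝓡 0) (𝓡∂ (0 + 1)) X.incl s (v i)
    have hw : LinearIndependent ℝ w := by
      exact (linearIndependent_unique_iff (ι := Fin 1) (v := w)).2 hν0
    let b := basisOfLinearIndependentOfCardEqFinrank hw (by simp [V])
    have hb : ⇑b = w := coe_basisOfLinearIndependentOfCardEqFinrank hw _
    have := positiveFrame_neg_basis (V := V) b (X.orient (X.incl s))
    rw [hb] at this
    exact this.symm
  | succ m =>
    rw [positiveFrame_neg_flip _ _ 0, X.boundary_orient s ν hν,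
      positiveFrame_neg_flip _ _ (Fin.succ 0)]
    refine iff_of_eq (congrArg (PositiveFrame (X.orient (X.incl s))) (funext fun i => ?_))
    refine Fin.cases ?_ (fun i => ?_) i
    · rfl
    · by_cases hi : i = 0
      · subst hi; simp
      · rw [Function.update_of_ne (fun h => hi (Fin.succ_injective _ h))]
        simp [hi]

/-- The same manifold with the opposite orientation; its boundary is `S.reverse`. -/
abbrev reverse {m : ℕ} {S : ClosedManifold.{u} m} (X : ManifoldWithBoundary S) :
    ManifoldWithBoundary S.reverse where
  carrier := X.carrier
  orient := fun x => -X.orient x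
  isOrientation := X.isOrientation.neg _ (EuclideanSpace.basisFun (Fin (m + 1)) ℝ).toBasis
  incl := X.incl
  contMDiff_incl := X.contMDiff_incl
  isEmbedding_incl := X.isEmbedding_incl
  mfderiv_incl_injective := X.mfderiv_incl_injective
  range_incl := X.range_incl
  boundary_orient := X.boundary_orient_neg

end ManifoldWithBoundary

/-- `i` is an orientation-preserving smooth embedding of `X` as a codimension-`0` submanifold with
boundary of the closed manifold `M` (see `PreservesOrientation` for the differential). -/
structure IsOrientedEmbedding {m : ℕ} {S : ClosedManifold.{u} m} (X : ManifoldWithBoundary S)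
    (M : ClosedManifold.{u} (m + 1)) (i : X → M) : Prop where
  contMDiff : ContMDiff (𝓡∂ (m + 1)) (𝓡 (m + 1)) ∞ i
  isEmbedding : Topology.IsEmbedding i
  preservesOrientation : PreservesOrientation (𝓡∂ (m + 1)) (𝓡 (m + 1)) X.orient M.orient i

/-- `M` is a manifold `X ∪_f Y` obtained by gluing `X` and `Y` along the diffeomorphism `f` of
their boundaries: `M` is the union of an embedded copy of `X` and an embedded copy of `Y` which
meet exactly in their boundaries, identified by `f`. (The smooth structure of the glued manifold is
unique only up to diffeomorphism, so this is a property of `M`.) -/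
def IsGluing {m : ℕ} {S T : ClosedManifold.{u} m} (X : ManifoldWithBoundary S)
    (Y : ManifoldWithBoundary T) (f : S ≃ₘ⟮𝓡 m, 𝓡 m⟯ T) (M : ClosedManifold.{u} (m + 1)) : Prop :=
  ∃ (i : X → M) (j : Y → M), IsOrientedEmbedding X M i ∧ IsOrientedEmbedding Y M j ∧
    Set.range i ∪ Set.range j = Set.univ ∧
    ∀ x y, i x = j y ↔ ∃ s : S, X.incl s = x ∧ Y.incl (f s) = y

/-- `D` is the double of `X`, the gluing of `X` and its reverse along the identity. -/
def IsDouble {m : ℕ} {S : ClosedManifold.{u} m} (X : ManifoldWithBoundary S)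
    (D : ClosedManifold.{u} (m + 1)) : Prop :=
  IsGluing X X.reverse (Diffeomorph.refl (𝓡 m) S ∞) D

/-! ### The SKK groups -/

/-- `f` is an orientation-preserving diffeomorphism from `S` to `T`. -/
def IsOrientedDiffeo {m : ℕ} (S T : ClosedManifold.{u} m) (f : S ≃ₘ⟮𝓡 m, 𝓡 m⟯ T) : Prop :=
  PreservesOrientation (𝓡 m) (𝓡 m) S.orient T.orient f

/-- The elements `[X₁ ∪_f X₂] - [X₁ ∪_g X₂] - [Y₁ ∪_f Y₂] + [Y₁ ∪_g Y₂]`, where `X₁`, `Y₁` have the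
same boundary `S`, where `X₂`, `Y₂` have the same boundary `T`, and where `f`, `g` are
orientation-preserving diffeomorphisms from `S` to the reverse of `T`. In dimension `0` all
boundaries are empty and there is nothing to impose. -/
def skkRelators : (n : ℕ) → Set (ManifoldGroup.{u} n)
  | 0 => ∅
  | m + 1 => {r | ∃ (S T : ClosedManifold.{u} m) (X₁ Y₁ : ManifoldWithBoundary S)
      (X₂ Y₂ : ManifoldWithBoundary T) (f g : S ≃ₘ⟮𝓡 m, 𝓡 m⟯ T)
      (M N M' N' : ClosedManifold.{u} (m + 1)),
      IsOrientedDiffeo S T.reverse f ∧ IsOrientedDiffeo S T.reverse g ∧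
      IsGluing X₁ X₂ f M ∧ IsGluing X₁ X₂ g N ∧ IsGluing Y₁ Y₂ f M' ∧ IsGluing Y₁ Y₂ g N' ∧
      r = ManifoldGroup.mk M - ManifoldGroup.mk N - ManifoldGroup.mk M' + ManifoldGroup.mk N'}

/-- The group `SKK_n`. -/
abbrev SKK (n : ℕ) : Type (u + 1) :=
  ManifoldGroup.{u} n ⧸ AddSubgroup.closure (skkRelators.{u} n)

/-- The class of a closed oriented manifold in `SKK_n`. -/
def SKK.mk {n : ℕ} (M : ClosedManifold.{u} n) : SKK.{u} n :=
  QuotientAddGroup.mk (ManifoldGroup.mk M)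

end CutPaste

end

/- In `SKK`, the difference `[X ∪_f Y] - [X' ∪_f Y]` depends neither on `Y` nor on `f`. Indeed, for
`X`, `X'` with boundary `S` and `f : S → T`, `f' : S → T'`, both `(X ∪_f Y) ⊔ (X' ∪_f' Y')` and
`(X ∪_f' Y') ⊔ (X' ∪_f Y)` are gluings of `X ⊔ X'` and `Y ⊔ Y'`, and replacing `X` by `X'` turns
both of them into `(X' ∪_f Y) ⊔ (X' ∪_f' Y')`. The theorem is the case in which `X'` is `X₂` with
its boundary identified with `S₁` through `f`, `Y` is the reverse of `X₂`, and `Y'` is `X₃`. -/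

namespace CutPaste

/-! ### Maps between disjoint unions -/

theorem isEmbedding_sumMap {A B C D : Type*} [TopologicalSpace A] [TopologicalSpace B]
    [TopologicalSpace C] [TopologicalSpace D] {f : A → C} {g : B → D}
    (hf : Topology.IsEmbedding f) (hg : Topology.IsEmbedding g) :
    Topology.IsEmbedding (Sum.map f g) :=
  (Topology.IsEmbedding.inl.comp hf).sumElim_of_separatedNhds (Topology.IsEmbedding.inr.comp hg)
    ⟨Set.range Sum.inl, Set.range Sum.inr, isOpen_range_inl, isOpen_range_inr,
      Set.range_comp_subset_range f Sum.inl, Set.range_comp_subset_range g Sum.inr,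
      Set.isCompl_range_inl_range_inr.disjoint⟩

section Derivative

variable {𝕜 E H E' H' M N M' N' : Type*} [NontriviallyNormedField 𝕜]
  [NormedAddCommGroup E] [NormedSpace 𝕜 E] [TopologicalSpace H] (I : ModelWithCorners 𝕜 E H)
  [NormedAddCommGroup E'] [NormedSpace 𝕜 E'] [TopologicalSpace H'] (I' : ModelWithCorners 𝕜 E' H')
  [TopologicalSpace M] [ChartedSpace H M] [TopologicalSpace N] [ChartedSpace H N]
  [TopologicalSpace M'] [ChartedSpace H' M'] [TopologicalSpace N'] [ChartedSpace H' N']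

theorem writtenInExtChartAt_sumMap_inl (f : M → M') (g : N → N') (x : M) :
    writtenInExtChartAt I I' (Sum.inl x) (Sum.map f g) = writtenInExtChartAt I I' x f := by
  funext y
  simp [writtenInExtChartAt, extChartAt, ChartedSpace.sum_chartAt_inl,
    Sum.inl_injective.extend_apply]

theorem writtenInExtChartAt_sumMap_inr (f : M → M') (g : N → N') (y : N) :
    writtenInExtChartAt I I' (Sum.inr y) (Sum.map f g) = writtenInExtChartAt I I' y g := by
  funext z
  simp [writtenInExtChartAt, extChartAt, ChartedSpace.sum_chartAt_inr,
    Sum.inr_injective.extend_apply]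

theorem mdifferentiableAt_sumMap_inl (f : M → M') (g : N → N') (x : M) :
    MDifferentiableAt I I' (Sum.map f g) (Sum.inl x) ↔ MDifferentiableAt I I' f x := by
  have hc : ContinuousAt (Sum.map f g) (Sum.inl x) ↔ ContinuousAt f x :=
    Topology.IsOpenEmbedding.inl.continuousAt_iff.symm.trans
      Topology.IsOpenEmbedding.inl.isInducing.continuousAt_iff.symm
  rw [mdifferentiableAt_iff, mdifferentiableAt_iff, hc, writtenInExtChartAt_sumMap_inl,
    extChartAt_inl_apply]

theorem mfderiv_sumMap_inl (f : M → M') (g : N → N') (x : M) :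
    mfderiv I I' (Sum.map f g) (Sum.inl x) = mfderiv I I' f x := by
  simp only [mfderiv, writtenInExtChartAt_sumMap_inl, extChartAt_inl_apply]
  classical exact if_congr (mdifferentiableAt_sumMap_inl I I' f g x) rfl rfl

theorem mdifferentiableAt_sumMap_inr (f : M → M') (g : N → N') (y : N) :
    MDifferentiableAt I I' (Sum.map f g) (Sum.inr y) ↔ MDifferentiableAt I I' g y := by
  have hc : ContinuousAt (Sum.map f g) (Sum.inr y) ↔ ContinuousAt g y :=
    Topology.IsOpenEmbedding.inr.continuousAt_iff.symm.trans
      Topology.IsOpenEmbedding.inr.isInducing.continuousAt_iff.symm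
  rw [mdifferentiableAt_iff, mdifferentiableAt_iff, hc, writtenInExtChartAt_sumMap_inr,
    extChartAt_inr_apply]

theorem mfderiv_sumMap_inr (f : M → M') (g : N → N') (y : N) :
    mfderiv I I' (Sum.map f g) (Sum.inr y) = mfderiv I I' g y := by
  simp only [mfderiv, writtenInExtChartAt_sumMap_inr, extChartAt_inr_apply]
  classical exact if_congr (mdifferentiableAt_sumMap_inr I I' f g y) rfl rfl

end Derivative

section Orientation

variable {n : ℕ} {E H E' H' M N M' N' : Type*} [NormedAddCommGroup E] [NormedSpace ℝ E]
  [TopologicalSpace H] {I : ModelWithCorners ℝ E H} [NormedAddCommGroup E'] [NormedSpace ℝ E']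
  [TopologicalSpace H'] {I' : ModelWithCorners ℝ E' H'}
  [TopologicalSpace M] [ChartedSpace H M] [TopologicalSpace N] [ChartedSpace H N]
  [TopologicalSpace M'] [ChartedSpace H' M'] [TopologicalSpace N'] [ChartedSpace H' N']
  {oM : ∀ x : M, Orientation ℝ (TangentSpace I x) (Fin n)}
  {oN : ∀ x : N, Orientation ℝ (TangentSpace I x) (Fin n)}
  {oM' : ∀ x : M', Orientation ℝ (TangentSpace I' x) (Fin n)}
  {oN' : ∀ x : N', Orientation ℝ (TangentSpace I' x) (Fin n)}

theorem sumOrient_neg :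
    sumOrient I (fun x => -oM x) (fun y => -oN y) = fun z => -sumOrient I oM oN z := by
  funext z
  cases z <;> rfl

theorem PreservesOrientation.sumMap {f : M → M'} {g : N → N'}
    (hf : PreservesOrientation I I' oM oM' f) (hg : PreservesOrientation I I' oN oN' g) :
    PreservesOrientation I I' (sumOrient I oM oN) (sumOrient I' oM' oN') (Sum.map f g) := by
  rintro (x | y) v
  · rw [mfderiv_sumMap_inl]
    exact hf x v
  · rw [mfderiv_sumMap_inr]
    exact hg y v

theorem preservesOrientation_sumSwap :
    PreservesOrientation I I (sumOrient I oM oN) (sumOrient I oN oM) Sum.swap := by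
  rintro (x | y) v
  all_goals
    rw [mfderiv_sumSwap]
    exact Iff.rfl

end Orientation

/-! ### Disjoint unions and identifications of boundaries -/

section IsOutward

variable {m : ℕ} {X Y : Type*} [TopologicalSpace X] [ChartedSpace (EuclideanHalfSpace (m + 1)) X]
  [IsManifold (𝓡∂ (m + 1)) 1 X] [TopologicalSpace Y] [ChartedSpace (EuclideanHalfSpace (m + 1)) Y]
  [IsManifold (𝓡∂ (m + 1)) 1 Y]

theorem isOutward_inl (x : X) (ν : TangentSpace (𝓡∂ (m + 1)) x) :
    IsOutward (Sum.inl x : X ⊕ Y) ν ↔ IsOutward x ν := by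
  have hcomp : extChartAt (𝓡∂ (m + 1)) (Sum.inl x : X ⊕ Y) ∘ Sum.inl =
      extChartAt (𝓡∂ (m + 1)) x := funext fun _ => extChartAt_inl_apply
  have hderiv := mfderiv_inl_apply (N := Y) (𝓡∂ (m + 1)) _
    (mdifferentiableAt_extChartAt (mem_chart_source _ (Sum.inl x))) ν
  rw [hcomp] at hderiv
  simp only [IsOutward, hderiv]

theorem isOutward_inr (y : Y) (ν : TangentSpace (𝓡∂ (m + 1)) y) :
    IsOutward (Sum.inr y : X ⊕ Y) ν ↔ IsOutward y ν := by
  have hcomp : extChartAt (𝓡∂ (m + 1)) (Sum.inr y : X ⊕ Y) ∘ Sum.inr =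
      extChartAt (𝓡∂ (m + 1)) y := funext fun _ => extChartAt_inr_apply
  have hderiv := mfderiv_inr_apply (M := X) (𝓡∂ (m + 1)) _
    (mdifferentiableAt_extChartAt (mem_chart_source _ (Sum.inr y))) ν
  rw [hcomp] at hderiv
  simp only [IsOutward, hderiv]

end IsOutward

variable {m : ℕ} {S T S' T' : ClosedManifold.{u} m}

namespace ManifoldWithBoundary

/-- The disjoint union `X ⊔ Y`, whose boundary is the disjoint union of the boundaries. -/
noncomputable abbrev sum (X : ManifoldWithBoundary S) (Y : ManifoldWithBoundary T) :
    ManifoldWithBoundary (S.sum T) where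
  carrier := X.carrier ⊕ Y.carrier
  orient := sumOrient (𝓡∂ (m + 1)) X.orient Y.orient
  isOrientation := X.isOrientation.sum Y.isOrientation
  incl := Sum.map X.incl Y.incl
  contMDiff_incl := X.contMDiff_incl.sumMap Y.contMDiff_incl
  isEmbedding_incl := isEmbedding_sumMap X.isEmbedding_incl Y.isEmbedding_incl
  mfderiv_incl_injective := by
    rintro (s | t)
    · rw [mfderiv_sumMap_inl]
      exact X.mfderiv_incl_injective s
    · rw [mfderiv_sumMap_inr]
      exact Y.mfderiv_incl_injective t
  range_incl := by
    rw [ModelWithCorners.boundary_disjointUnion, ← X.range_incl, ← Y.range_incl]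
    ext (x | y) <;> simp
  boundary_orient := by
    rintro (s | t) ν hν
    · rw [mfderiv_sumMap_inl]
      exact X.boundary_orient s ν ((isOutward_inl _ _).1 hν)
    · rw [mfderiv_sumMap_inr]
      exact Y.boundary_orient t ν ((isOutward_inr _ _).1 hν)

/-- The manifold `X` with boundary `T`, regarded as a manifold with boundary `S` by means of an
orientation-preserving diffeomorphism `f : S → T`. -/
noncomputable abbrev comapBoundary (X : ManifoldWithBoundary T) (f : S ≃ₘ⟮𝓡 m, 𝓡 m⟯ T)
    (hf : IsOrientedDiffeo S T f) : ManifoldWithBoundary S :=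
  have hderiv (s : S) : mfderiv (𝓡 m) (𝓡∂ (m + 1)) (X.incl ∘ f) s =
      (mfderiv (𝓡 m) (𝓡∂ (m + 1)) X.incl (f s)).comp (mfderiv (𝓡 m) (𝓡 m) f s) :=
    mfderiv_comp s (X.contMDiff_incl.mdifferentiable (by simp) _)
      (f.mdifferentiable (by simp) _)
  { carrier := X.carrier
    orient := X.orient
    isOrientation := X.isOrientation
    incl := X.incl ∘ f
    contMDiff_incl := X.contMDiff_incl.comp f.contMDiff
    isEmbedding_incl := X.isEmbedding_incl.comp f.toHomeomorph.isEmbedding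
    mfderiv_incl_injective := fun s => by
      rw [hderiv]
      exact (X.mfderiv_incl_injective (f s)).comp
        (f.mfderivToContinuousLinearEquiv (by simp) s).injective
    range_incl := (f.surjective.range_comp X.incl).trans X.range_incl
    boundary_orient := fun s ν hν v => by
      rw [hderiv]
      exact (hf s v).trans (X.boundary_orient (f s) ν hν _) }

end ManifoldWithBoundary

theorem isOrientedDiffeo_refl (S : ClosedManifold.{u} m) :
    IsOrientedDiffeo S S (Diffeomorph.refl (𝓡 m) S ∞) :=
  preservesOrientation_id (𝓡 m) S.orient

theorem isOrientedDiffeo_sumComm (S T : ClosedManifold.{u} m) :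
    IsOrientedDiffeo (S.sum T) (T.sum S) (Diffeomorph.sumComm (𝓡 m) S ∞ T) :=
  preservesOrientation_sumSwap

theorem IsOrientedDiffeo.trans {f : S ≃ₘ⟮𝓡 m, 𝓡 m⟯ T} {g : T ≃ₘ⟮𝓡 m, 𝓡 m⟯ S'}
    (hf : IsOrientedDiffeo S T f) (hg : IsOrientedDiffeo T S' g) :
    IsOrientedDiffeo S S' (f.trans g) :=
  PreservesOrientation.comp (f := f) (g := g) hg hf (g.mdifferentiable (by simp))
    (f.mdifferentiable (by simp))

theorem IsOrientedDiffeo.sumCongr {f : S ≃ₘ⟮𝓡 m, 𝓡 m⟯ T} {f' : S' ≃ₘ⟮𝓡 m, 𝓡 m⟯ T'}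
    (hf : IsOrientedDiffeo S T f) (hf' : IsOrientedDiffeo S' T' f') :
    IsOrientedDiffeo (S.sum S') (T.sum T') (f.sumCongr f') :=
  PreservesOrientation.sumMap hf hf'

theorem isOrientedDiffeo_reverse_reverse_iff {f : S ≃ₘ⟮𝓡 m, 𝓡 m⟯ T} :
    IsOrientedDiffeo S T.reverse.reverse f ↔ IsOrientedDiffeo S T f := by
  simp only [IsOrientedDiffeo, orientation_neg_neg]

theorem isOrientedDiffeo_reverse_sum_iff {f : S ≃ₘ⟮𝓡 m, 𝓡 m⟯ T.sum T'} :
    IsOrientedDiffeo S (T.sum T').reverse f ↔ IsOrientedDiffeo S (T.reverse.sum T'.reverse) f := by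
  simp only [IsOrientedDiffeo, sumOrient_neg]

/-! ### Gluings -/

section Gluing

variable {X : ManifoldWithBoundary S} {Y : ManifoldWithBoundary T} {X' : ManifoldWithBoundary S'}
  {Y' : ManifoldWithBoundary T'} {M N : ClosedManifold.{u} (m + 1)}

theorem IsOrientedEmbedding.sumMap {i : X → M} {j : Y → N} (hi : IsOrientedEmbedding X M i)
    (hj : IsOrientedEmbedding Y N j) :
    IsOrientedEmbedding (X.sum Y) (M.sum N) (Sum.map i j) where
  contMDiff := hi.contMDiff.sumMap hj.contMDiff
  isEmbedding := isEmbedding_sumMap hi.isEmbedding hj.isEmbedding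
  preservesOrientation := hi.preservesOrientation.sumMap hj.preservesOrientation

theorem IsOrientedEmbedding.comp_diffeomorph {i : X → M} (hi : IsOrientedEmbedding X M i)
    (φ : X' ≃ₘ⟮𝓡∂ (m + 1), 𝓡∂ (m + 1)⟯ X)
    (hφ : PreservesOrientation (𝓡∂ (m + 1)) (𝓡∂ (m + 1)) X'.orient X.orient φ) :
    IsOrientedEmbedding X' M (i ∘ φ) where
  contMDiff := hi.contMDiff.comp φ.contMDiff
  isEmbedding := hi.isEmbedding.comp φ.toHomeomorph.isEmbedding
  preservesOrientation := hi.preservesOrientation.comp hφ (hi.contMDiff.mdifferentiable (by simp))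
    (φ.mdifferentiable (by simp))

theorem IsGluing.congr_left {f : S ≃ₘ⟮𝓡 m, 𝓡 m⟯ T} (h : IsGluing X Y f M)
    (φ : X' ≃ₘ⟮𝓡∂ (m + 1), 𝓡∂ (m + 1)⟯ X)
    (hφ : PreservesOrientation (𝓡∂ (m + 1)) (𝓡∂ (m + 1)) X'.orient X.orient φ)
    (k : S' ≃ₘ⟮𝓡 m, 𝓡 m⟯ S) (hk : ∀ s, φ (X'.incl s) = X.incl (k s)) :
    IsGluing X' Y (k.trans f) M := by
  obtain ⟨i, j, hi, hj, hcover, hmeet⟩ := h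
  refine ⟨i ∘ φ, j, hi.comp_diffeomorph φ hφ, hj, ?_, fun x y => ?_⟩
  · rwa [EquivLike.range_comp]
  · rw [Function.comp_apply, hmeet, (EquivLike.surjective k).exists]
    simp only [← hk, (EquivLike.injective φ).eq_iff, Diffeomorph.coe_trans, Function.comp_apply]

theorem IsGluing.congr_right {f : S ≃ₘ⟮𝓡 m, 𝓡 m⟯ T} (h : IsGluing X Y f M)
    (φ : Y' ≃ₘ⟮𝓡∂ (m + 1), 𝓡∂ (m + 1)⟯ Y)
    (hφ : PreservesOrientation (𝓡∂ (m + 1)) (𝓡∂ (m + 1)) Y'.orient Y.orient φ)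
    (k : T ≃ₘ⟮𝓡 m, 𝓡 m⟯ T') (hk : ∀ t, φ (Y'.incl (k t)) = Y.incl t) :
    IsGluing X Y' (f.trans k) M := by
  obtain ⟨i, j, hi, hj, hcover, hmeet⟩ := h
  refine ⟨i, j ∘ φ, hi, hj.comp_diffeomorph φ hφ, ?_, fun x y => ?_⟩
  · rwa [EquivLike.range_comp]
  · rw [Function.comp_apply, hmeet]
    simp only [← hk, (EquivLike.injective φ).eq_iff, Diffeomorph.coe_trans, Function.comp_apply]

theorem IsGluing.comapBoundary {g : T ≃ₘ⟮𝓡 m, 𝓡 m⟯ T'} (h : IsGluing Y Y' g M)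
    {f : S ≃ₘ⟮𝓡 m, 𝓡 m⟯ T} (hf : IsOrientedDiffeo S T f) :
    IsGluing (Y.comapBoundary f hf) Y' (f.trans g) M :=
  h.congr_left (X' := Y.comapBoundary f hf) (Diffeomorph.refl (𝓡∂ (m + 1)) Y ∞)
    (preservesOrientation_id _ _) f fun _ => rfl

theorem IsGluing.trans_sumComm {f : S ≃ₘ⟮𝓡 m, 𝓡 m⟯ T.sum T'} (h : IsGluing X (Y.sum Y') f M) :
    IsGluing X (Y'.sum Y) (f.trans (Diffeomorph.sumComm (𝓡 m) T ∞ T')) M :=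
  h.congr_right (Y' := Y'.sum Y) (Diffeomorph.sumComm (𝓡∂ (m + 1)) Y' ∞ Y)
    preservesOrientation_sumSwap _ (by rintro (t | t) <;> rfl)

theorem IsGluing.sum {f : S ≃ₘ⟮𝓡 m, 𝓡 m⟯ T} {f' : S' ≃ₘ⟮𝓡 m, 𝓡 m⟯ T'}
    (h : IsGluing X Y f M) (h' : IsGluing X' Y' f' N) :
    IsGluing (X.sum X') (Y.sum Y') (f.sumCongr f') (M.sum N) := by
  obtain ⟨i, j, hi, hj, hcover, hmeet⟩ := h
  obtain ⟨i', j', hi', hj', hcover', hmeet'⟩ := h'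
  refine ⟨Sum.map i i', Sum.map j j', hi.sumMap hi', hj.sumMap hj', ?_, ?_⟩
  · refine Set.eq_univ_of_forall ?_
    rintro (z | z)
    · simpa using hcover.ge (Set.mem_univ z)
    · simpa using hcover'.ge (Set.mem_univ z)
  · rintro (x | x) (y | y) <;> simp [hmeet, hmeet']

end Gluing

/-! ### Relations in `SKK` -/

namespace SKK

theorem mk_sum {n : ℕ} (M N : ClosedManifold.{u} n) : mk (M.sum N) = mk M + mk N :=
  congrArg (QuotientAddGroup.mk' _) <| map_add
    (Algebra.GrothendieckAddGroup.of (M := ManifoldClass n))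
    (show ManifoldClass n from Quotient.mk _ M) (show ManifoldClass n from Quotient.mk _ N)

theorem mk_sub_mk_eq {X X' : ManifoldWithBoundary S} {Y Y' : ManifoldWithBoundary T}
    {f g : S ≃ₘ⟮𝓡 m, 𝓡 m⟯ T} {M N M' N' : ClosedManifold.{u} (m + 1)}
    (hf : IsOrientedDiffeo S T.reverse f) (hg : IsOrientedDiffeo S T.reverse g)
    (hM : IsGluing X Y f M) (hN : IsGluing X Y g N)
    (hM' : IsGluing X' Y' f M') (hN' : IsGluing X' Y' g N') :
    mk M - mk N = mk M' - mk N' := by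
  have hrel : mk M - mk N - mk M' + mk N' = 0 :=
    (QuotientAddGroup.eq_zero_iff _).2 <| AddSubgroup.subset_closure
      ⟨S, T, X, X', Y, Y', f, g, M, N, M', N', hf, hg, hM, hN, hM', hN', rfl⟩
  rw [← sub_eq_zero, ← hrel]
  abel

theorem mk_add_mk_exchange {X X' : ManifoldWithBoundary S} {Y : ManifoldWithBoundary T}
    {Y' : ManifoldWithBoundary T'} {f : S ≃ₘ⟮𝓡 m, 𝓡 m⟯ T} {f' : S ≃ₘ⟮𝓡 m, 𝓡 m⟯ T'}
    {A B C D : ClosedManifold.{u} (m + 1)}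
    (hf : IsOrientedDiffeo S T.reverse f) (hf' : IsOrientedDiffeo S T'.reverse f')
    (hA : IsGluing X Y f A) (hB : IsGluing X' Y' f' B)
    (hC : IsGluing X Y' f' C) (hD : IsGluing X' Y f D) :
    mk A + mk B = mk C + mk D := by
  have hparallel : IsOrientedDiffeo (S.sum S) (T.sum T').reverse (f.sumCongr f') :=
    isOrientedDiffeo_reverse_sum_iff.2 (hf.sumCongr hf')
  have hcrossed : IsOrientedDiffeo (S.sum S) (T.sum T').reverse
      ((f'.sumCongr f).trans (Diffeomorph.sumComm (𝓡 m) T' ∞ T)) :=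
    isOrientedDiffeo_reverse_sum_iff.2
      ((hf'.sumCongr hf).trans (isOrientedDiffeo_sumComm T'.reverse T.reverse))
  have hrel := mk_sub_mk_eq hparallel hcrossed (hA.sum hB) (hC.sum hD).trans_sumComm
    (hD.sum hB) (hB.sum hD).trans_sumComm
  simp only [mk_sum] at hrel
  rwa [add_comm (mk B) (mk D), sub_self, sub_eq_zero] at hrel

end SKK

end CutPaste

theorem mainTheorem5_general {m : ℕ} {S₁ S₂ T T' : CutPaste.ClosedManifold.{u} m}
    {X₁ : CutPaste.ManifoldWithBoundary S₁} {X₂ : CutPaste.ManifoldWithBoundary S₂}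
    {Y : CutPaste.ManifoldWithBoundary T} {Y' : CutPaste.ManifoldWithBoundary T'}
    {f : S₁ ≃ₘ⟮𝓡 m, 𝓡 m⟯ S₂} (hf : CutPaste.IsOrientedDiffeo S₁ S₂ f)
    {g : S₂ ≃ₘ⟮𝓡 m, 𝓡 m⟯ T} (hg : CutPaste.IsOrientedDiffeo S₂ T.reverse g)
    {g' : S₂ ≃ₘ⟮𝓡 m, 𝓡 m⟯ T'} (hg' : CutPaste.IsOrientedDiffeo S₂ T'.reverse g')
    {A B C D : CutPaste.ClosedManifold.{u} (m + 1)}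
    (hA : CutPaste.IsGluing X₁ Y (f.trans g) A) (hB : CutPaste.IsGluing X₂ Y' g' B)
    (hC : CutPaste.IsGluing X₁ Y' (f.trans g') C) (hD : CutPaste.IsGluing X₂ Y g D) :
    CutPaste.SKK.mk A + CutPaste.SKK.mk B = CutPaste.SKK.mk C + CutPaste.SKK.mk D :=
  CutPaste.SKK.mk_add_mk_exchange (hf.trans hg) (hf.trans hg') hA (hB.comapBoundary hf) hC
    (hD.comapBoundary hf)

theorem mainTheorem5 {m : ℕ} (S₁ S₂ S₃ : CutPaste.ClosedManifold.{u} m)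
    (X₁ : CutPaste.ManifoldWithBoundary S₁) (X₂ : CutPaste.ManifoldWithBoundary S₂)
    (X₃ : CutPaste.ManifoldWithBoundary S₃)
    (f : S₁ ≃ₘ⟮𝓡 m, 𝓡 m⟯ S₂) (hf : CutPaste.IsOrientedDiffeo S₁ S₂ f)
    (g : S₂ ≃ₘ⟮𝓡 m, 𝓡 m⟯ S₃) (hg : CutPaste.IsOrientedDiffeo S₂ S₃.reverse g)
    (A B C D : CutPaste.ClosedManifold.{u} (m + 1))
    (hA : CutPaste.IsGluing X₁ X₂.reverse f A)
    (hB : CutPaste.IsGluing X₂ X₃ g B)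
    (hC : CutPaste.IsGluing X₁ X₃ (f.trans g) C)
    (hD : CutPaste.IsDouble X₂ D) :
    CutPaste.SKK.mk A + CutPaste.SKK.mk B = CutPaste.SKK.mk C + CutPaste.SKK.mk D := by
  have hid : CutPaste.IsOrientedDiffeo S₂ S₂.reverse.reverse (Diffeomorph.refl (𝓡 m) S₂ ∞) :=
    CutPaste.isOrientedDiffeo_reverse_reverse_iff.2 (CutPaste.isOrientedDiffeo_refl S₂)
  exact mainTheorem5_general hf hid hg hA hB hC hD
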